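/- For a field $K$ and an integer $t\ge 0$, let $B_1(t,K)\in\mathbb{N}\cup\{\infty\}$ denote the supremum of the number of roots in $K^\ast=K\setminus\{0\}$, counted without multiplicities, that a non-zero polynomial in $K[x]$ with at most $t+1$ monomial terms can have. Theorem. Let $p$ be an odd prime number, let $K/\mathbb{Q}_p$ be a finite extension whose residue field has $q$ elements, and let $t\ge 1$ be an integer. Then $B_1(t,K)\ge(2t-1)(q-1)$. -/

import Mathlib

open Polynomial

/-- The set of roots of `f` in `K^* = K ∖ {0}` (so roots are counted without multiplicity). -/
def nonzeroRoots {K : Type*} [Field K] (f : K[X]) : Set K :=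
  {x : K | x ≠ 0 ∧ f.IsRoot x}

/-- `B₁(t, K)`: the supremum, in `ℕ ∪ {∞}`, of the number of distinct roots in `K^*` of a
non-zero polynomial in `K[x]` with at most `t + 1` monomial terms. -/
noncomputable def B₁ (t : ℕ) (K : Type*) [Field K] : ℕ∞ :=
  ⨆ (f : K[X]) (_ : f ≠ 0) (_ : f.support.card ≤ t + 1), (nonzeroRoots f).encard

/-- The valuation ring `{x ∈ K | |x| ≤ 1}` of a finite extension `K` of `ℚ_p`, where `|·|` is the
spectral norm, i.e. the unique absolute value of `K` that extends the `p`-adic one. -/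
noncomputable def padicValuationRing (p : ℕ) [Fact p.Prime] (K : Type*) [Field K]
    [Algebra ℚ_[p] K] [FiniteDimensional ℚ_[p] K] : ValuationSubring K where
  carrier := {x : K | spectralNorm ℚ_[p] K x ≤ 1}
  zero_mem' := by simp [spectralNorm_zero]
  one_mem' := by simp [spectralNorm_one]
  add_mem' := fun {x y} hx hy =>
    (isNonarchimedean_spectralNorm (K := ℚ_[p]) (L := K) x y).trans (max_le hx hy)
  neg_mem' := fun {x} hx => by
    simpa [spectralNorm_neg (Algebra.IsAlgebraic.isAlgebraic (R := ℚ_[p]) x)] using hx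
  mul_mem' := fun {x y} hx hy =>
    (spectralNorm_mul (Algebra.IsAlgebraic.isAlgebraic (R := ℚ_[p]) x)
      (Algebra.IsAlgebraic.isAlgebraic (R := ℚ_[p]) y)).trans
      (mul_le_one₀ hx (spectralNorm_nonneg y) hy)
  mem_or_inv_mem' := fun x => by
    have h : spectralNorm ℚ_[p] K x⁻¹ = (spectralNorm ℚ_[p] K x)⁻¹ :=
      map_inv₀ (spectralMulAlgNorm ℚ_[p] K) x
    rcases le_total (spectralNorm ℚ_[p] K x) 1 with hx | hx
    · exact Or.inl hx
    · exact Or.inr (h.le.trans (inv_le_one_of_one_le₀ hx))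

/-! ### Hensel's lemma and perturbation of simple roots -/

section Hensel

variable {p : ℕ} [Fact p.Prime]

/-! Everything is reduced to `ℚ_[p]`. Put m = q - 1; `K` contains q - 1 distinct m-th roots of unity
(Teichmüller lifts, `exists_rootsOfUnity_lift`). If f over `ℚ_[p]` has N nonzero roots that are m-th
powers, then f(x^m) has as many terms as f and at least N(q - 1) nonzero roots in `K`
(`le_B₁_of_pow_roots`). So it suffices to find f with t + 1 terms and 2t - 1 such roots.

This goes by induction from x - 1, each new monomial adding two simple roots
(`Padic.exists_sparse_add_two_roots`). Take an m-th power r of large norm and pass to f -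
f(r)(x/r)^M. For large M the new monomial is tiny near the old roots, which are smaller than r; by
Hensel they move only slightly, staying simple, distinct and m-th powers. At r there is a root by
construction. If the integer M is also p-adically close to the logarithmic derivative rf'(r)/f(r),
this root is almost double, and a nonvanishing second-order term forces a second simple root r(1 +
z) nearby. Since the natural numbers are dense in `ℤ_[p]`, M can be both large and p-adically
prescribed. -/

theorem PadicInt.exists_simple_root_norm_mul_le {P : ℤ_[p][X]}
    (h : ‖P.coeff 0‖ < ‖P.coeff 1‖ ^ 2) :
    ∃ z : ℤ_[p], P.eval z = 0 ∧ P.derivative.eval z ≠ 0 ∧ ‖z‖ * ‖P.coeff 1‖ ≤ ‖P.coeff 0‖ := by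
  have e0 : P.eval 0 = P.coeff 0 := by rw [coeff_zero_eq_eval_zero]
  have e1 : P.derivative.eval 0 = P.coeff 1 := by
    rw [← coeff_zero_eq_eval_zero, coeff_derivative]; simp
  have hpos : 0 < ‖P.coeff 1‖ := by
    by_contra hc
    have : ‖P.coeff 1‖ = 0 := le_antisymm (not_lt.mp hc) (norm_nonneg _)
    rw [this] at h
    have := norm_nonneg (P.coeff 0)
    simp at h
    linarith
  have ev (Q : ℤ_[p][X]) (x : ℤ_[p]) : aeval x Q = Q.eval x := by
    rw [aeval_def, eval₂_eq_eval_map]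
    exact congrArg (eval x) Q.map_id
  obtain ⟨z, hz, hlt, hd, -⟩ := hensels_lemma (F := P) (a := 0)
    (by rwa [ev, ev, e0, e1])
  rw [ev] at hz
  rw [ev, e1, sub_zero] at hlt
  rw [ev, ev, e1] at hd
  refine ⟨z, hz, fun h0 => ?_, ?_⟩
  · rw [h0, norm_zero] at hd
    exact hpos.ne hd
  -- Expanding at 0 gives 0 = P₀ + z(P₁ + kz), and the bracket has the norm of P₁ because z is
  -- smaller than P₁.
  · obtain ⟨k, hk⟩ := P.binomExpansion 0 z
    rw [zero_add, hz, e0, e1] at hk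
    have h0 : P.coeff 0 = -(z * (P.coeff 1 + k * z)) := by linear_combination -hk
    have h1 : ‖P.coeff 1 + k * z‖ = ‖P.coeff 1‖ := by
      have hkz : ‖k * z‖ < ‖P.coeff 1‖ := by
        rw [norm_mul]
        exact (mul_le_of_le_one_left (norm_nonneg _) (PadicInt.norm_le_one k)).trans_lt hlt
      rw [PadicInt.norm_add_eq_max_of_ne hkz.ne', max_eq_left hkz.le]
    rw [h0, norm_neg, norm_mul, h1]

/-- Hensel at 0 for (1 + X)^m - (1 + v), whose linear coefficient is m. It ensures that m-th powers
stay m-th powers when roots move slightly. -/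
theorem PadicInt.exists_pow_eq_one_add (p : ℕ) [Fact p.Prime] {m : ℕ} (hm : m ≠ 0) :
    ∃ δ > 0, ∀ v : ℤ_[p], ‖v‖ < δ → ∃ w : ℤ_[p], w ^ m = 1 + v := by
  refine ⟨‖(m : ℤ_[p])‖ ^ 2, pow_pos (norm_pos_iff.mpr (Nat.cast_ne_zero.mpr hm)) 2, fun v hv => ?_⟩
  have c0 : ((1 + X) ^ m - C (1 + v) : ℤ_[p][X]).coeff 0 = -v := by
    rw [coeff_sub, coeff_one_add_X_pow]; simp
  have c1 : ((1 + X) ^ m - C (1 + v) : ℤ_[p][X]).coeff 1 = m := by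
    rw [coeff_sub, coeff_one_add_X_pow, coeff_C]; simp
  obtain ⟨z, hz, -⟩ := PadicInt.exists_simple_root_norm_mul_le
    (P := (1 + X) ^ m - C (1 + v)) (by rw [c0, c1, norm_neg]; exact hv)
  exact ⟨1 + z, by simpa [sub_eq_zero] using hz⟩

theorem PadicInt.exists_natCast_near (l : ℤ_[p]) {δ : ℝ} (hδ : 0 < δ) (A : ℕ) :
    ∃ M ≥ A, ‖l - M‖ < δ := by
  obtain ⟨n, hn⟩ := PadicInt.denseRange_natCast.exists_dist_lt l hδ
  obtain ⟨k, hk⟩ := PadicInt.exists_pow_neg_lt p hδ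
  have hp : 1 < p := (Fact.out : p.Prime).one_lt
  -- Adding a high power of p makes the integer large without disturbing the p-adic approximation.
  refine ⟨n + p ^ (A + k), ?_, ?_⟩
  · have := Nat.lt_pow_self hp (n := A + k)
    omega
  · have h1 : ‖(p : ℤ_[p]) ^ (A + k)‖ < δ := by
      rw [pow_add, norm_mul, PadicInt.norm_p_pow k]
      exact (mul_le_of_le_one_left (by positivity) (PadicInt.norm_le_one (p := p) _)).trans_lt hk
    have : l - ((n + p ^ (A + k) : ℕ) : ℤ_[p]) = (l - n) + -(p : ℤ_[p]) ^ (A + k) := by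
      push_cast; ring
    rw [this]
    refine (PadicInt.nonarchimedean _ _).trans_lt (max_lt ?_ ?_)
    · rwa [← dist_eq_norm]
    · rwa [norm_neg]

/-- Simple roots of an integral model `P` of `F (s (1 + X))` are simple roots of `F`. -/
theorem Padic.simple_root_of_integral_model {F : ℚ_[p][X]} {P : ℤ_[p][X]} {b s : ℚ_[p]}
    (hb : b ≠ 0) (h : P.map PadicInt.Coe.ringHom = C b * F.comp (C s * (1 + X))) {z : ℤ_[p]}
    (h0 : P.eval z = 0) (h1 : P.derivative.eval z ≠ 0) :
    F.eval (s * (1 + z)) = 0 ∧ F.derivative.eval (s * (1 + z)) ≠ 0 := by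
  have e0 : (P.map PadicInt.Coe.ringHom).eval (z : ℚ_[p]) = ((P.eval z : ℤ_[p]) : ℚ_[p]) :=
    eval_map_apply PadicInt.Coe.ringHom z
  have e1 : (P.map PadicInt.Coe.ringHom).derivative.eval (z : ℚ_[p]) =
      ((P.derivative.eval z : ℤ_[p]) : ℚ_[p]) := by
    rw [derivative_map]; exact eval_map_apply PadicInt.Coe.ringHom z
  rw [h, h0] at e0
  rw [h] at e1
  have e1' : ((P.derivative.eval z : ℤ_[p]) : ℚ_[p]) ≠ 0 := by
    exact fun h2 => h1 (Subtype.ext h2)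
  rw [← e1] at e1'
  simp [derivative_comp, eval_comp, hb] at e0 e1'
  exact ⟨e0, e1'.2⟩

theorem Padic.exists_integral_multiple (g : ℚ_[p][X]) :
    ∃ b : ℚ_[p], b ≠ 0 ∧ ∃ P : ℤ_[p][X], P.map PadicInt.Coe.ringHom = C b * g := by
  obtain ⟨b, hb, h⟩ := IsLocalization.integerNormalization_spec (nonZeroDivisors ℤ_[p]) g
  refine ⟨(b : ℚ_[p]), fun h0 => nonZeroDivisors.ne_zero hb (Subtype.ext h0), _, h.trans ?_⟩
  ext n
  simp [Algebra.smul_def]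

theorem Padic.map_sub_pow_eq_model {f : ℚ_[p][X]} {P : ℤ_[p][X]} {b s c : ℚ_[p]} {η : ℤ_[p]}
    {M : ℕ} (h : P.map PadicInt.Coe.ringHom = C b * f.comp (C s * (1 + X)))
    (hη : (η : ℚ_[p]) = b * c * s ^ M) :
    (P - C η * (1 + X) ^ M).map PadicInt.Coe.ringHom =
      C b * (f - C c * X ^ M).comp (C s * (1 + X)) := by
  have : PadicInt.Coe.ringHom η = b * c * s ^ M := hη
  simp only [Polynomial.map_sub, Polynomial.map_mul, Polynomial.map_pow, Polynomial.map_add,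
    Polynomial.map_one, map_X, map_C, h, this, sub_comp, mul_comp, C_comp, X_pow_comp, mul_pow,
    C_mul, C_pow]
  ring

/-- A simple root persists when a monomial which is small near the root is added. -/
theorem Padic.eventually_exists_simple_root_near {f : ℚ_[p][X]} {r s : ℚ_[p]}
    (h0 : f.eval s = 0) (h1 : f.derivative.eval s ≠ 0) (hs : s ≠ 0) (hsr : ‖s‖ < ‖r‖) {ε : ℝ}
    (hε : 0 < ε) (a : ℚ_[p]) : ∀ᶠ M : ℕ in Filter.atTop, ∃ z : ℤ_[p], ‖z‖ < ε ∧
      (f - C (a / r ^ M) * X ^ M).eval (s * (1 + z)) = 0 ∧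
      (f - C (a / r ^ M) * X ^ M).derivative.eval (s * (1 + z)) ≠ 0 := by
  obtain ⟨b, hb, P, hP⟩ := Padic.exists_integral_multiple (f.comp (C s * (1 + X)))
  have c0 : ((P.coeff 0 : ℤ_[p]) : ℚ_[p]) = 0 := by
    have : (P.map PadicInt.Coe.ringHom).coeff 0 = 0 := by
      rw [hP, coeff_zero_eq_eval_zero]; simp [eval_comp, h0]
    rwa [coeff_map] at this
  have c1 : ((P.coeff 1 : ℤ_[p]) : ℚ_[p]) = b * (s * f.derivative.eval s) := by
    have : (P.map PadicInt.Coe.ringHom).derivative.coeff 0 = b * (s * f.derivative.eval s) := by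
      rw [hP, coeff_zero_eq_eval_zero]; simp [eval_comp, derivative_comp]
    rw [coeff_derivative, coeff_map] at this
    rw [← this]
    norm_num
    rfl
  have c0' : P.coeff 0 = 0 := Subtype.ext c0
  have hpos : 0 < ‖P.coeff 1‖ := by
    rw [norm_pos_iff]
    intro h
    rw [h] at c1
    exact mul_ne_zero hb (mul_ne_zero hs h1) (by simpa using c1.symm)
  have hle : ‖P.coeff 1‖ ≤ 1 := PadicInt.norm_le_one _
  have hr : r ≠ 0 := norm_pos_iff.mp ((norm_nonneg s).trans_lt hsr)
  have hlim : Filter.Tendsto (fun M : ℕ => ‖b * a * (s / r) ^ M‖) Filter.atTop (nhds 0) := by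
    have h2 : ‖s / r‖ < 1 := by
      rw [norm_div]; exact (div_lt_one (norm_pos_iff.mpr hr)).mpr hsr
    have := (tendsto_pow_atTop_nhds_zero_of_norm_lt_one h2).const_mul (b * a)
    simpa using this.norm
  -- The first bound is the Hensel condition; the second makes the displacement less than ε.
  filter_upwards [hlim.eventually_lt_const (show 0 < ‖P.coeff 1‖ ^ 2 by positivity),
    hlim.eventually_lt_const (show 0 < ε * ‖P.coeff 1‖ by positivity)] with M hM1 hM2
  have hη1 : ‖b * a * (s / r) ^ M‖ ≤ 1 := hM1.le.trans (pow_le_one₀ hpos.le hle)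
  set η : ℤ_[p] := ⟨b * a * (s / r) ^ M, hη1⟩ with hη
  have hηn : ‖η‖ = ‖b * a * (s / r) ^ M‖ := rfl
  rw [← hηn] at hM1 hM2
  have g0 : (P - C η * (1 + X) ^ M).coeff 0 = -η := by
    rw [coeff_sub, coeff_C_mul, coeff_one_add_X_pow, c0']; simp
  have g1 : ‖(P - C η * (1 + X) ^ M).coeff 1‖ = ‖P.coeff 1‖ := by
    rw [coeff_sub, coeff_C_mul, coeff_one_add_X_pow, sub_eq_add_neg]
    have : ‖-(η * ((M.choose 1 : ℕ) : ℤ_[p]))‖ < ‖P.coeff 1‖ := by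
      rw [norm_neg, norm_mul]
      refine (mul_le_of_le_one_right (norm_nonneg _) (PadicInt.norm_le_one _)).trans_lt
        (hM1.trans_le ?_)
      rw [sq]
      exact mul_le_of_le_one_left hpos.le hle
    rw [PadicInt.norm_add_eq_max_of_ne this.ne', max_eq_left this.le]
  obtain ⟨z, hz0, hz1, hz⟩ := PadicInt.exists_simple_root_norm_mul_le
    (P := P - C η * (1 + X) ^ M) (by rw [g0, g1, norm_neg]; exact hM1)
  rw [g0, g1, norm_neg] at hz
  refine ⟨z, lt_of_mul_lt_mul_right (hz.trans_lt hM2) hpos.le, ?_⟩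
  refine Padic.simple_root_of_integral_model hb (Padic.map_sub_pow_eq_model hP ?_) hz0 hz1
  change b * a * (s / r) ^ M = _
  rw [div_pow]
  ring

/-- Two simple roots arise near `r` when `M` is close to the logarithmic derivative at `r`. -/
theorem Padic.exists_two_simple_roots {f : ℚ_[p][X]} {P : ℤ_[p][X]} {r : ℚ_[p]}
    (hr : r ≠ 0) (hf : f.eval r ≠ 0)
    (hP : P.map PadicInt.Coe.ringHom = C (f.eval r)⁻¹ * f.comp (C r * (1 + X)))
    (hκ : 2 * P.coeff 2 - P.coeff 1 ^ 2 + P.coeff 1 ≠ 0) {ε : ℝ} (hε : 0 < ε) :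
    ∃ δ > 0, ∀ M : ℕ, ‖P.coeff 1 - M‖ < δ → P.coeff 1 ≠ M →
      ((f - C (f.eval r / r ^ M) * X ^ M).eval r = 0 ∧
        (f - C (f.eval r / r ^ M) * X ^ M).derivative.eval r ≠ 0) ∧
      ∃ z : ℤ_[p], z ≠ 0 ∧ ‖z‖ < ε ∧
        (f - C (f.eval r / r ^ M) * X ^ M).eval (r * (1 + z)) = 0 ∧
        (f - C (f.eval r / r ^ M) * X ^ M).derivative.eval (r * (1 + z)) ≠ 0 := by
  -- With a₁ = `P.coeff 1` = rf'(r)/f(r), κ is twice the X² coefficient of P - (1 + X)^a₁, the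
  -- limiting case of G below as M tends to a₁.
  set κ := 2 * P.coeff 2 - P.coeff 1 ^ 2 + P.coeff 1 with hκd
  have hκ0 : 0 < ‖κ‖ := norm_pos_iff.mpr hκ
  have hκ1 : ‖κ‖ ≤ 1 := PadicInt.norm_le_one _
  refine ⟨min (‖κ‖ ^ 2) (ε * ‖κ‖), by positivity, fun M hM hne => ?_⟩
  obtain ⟨hM1, hM2⟩ := lt_min_iff.mp hM
  set G : ℤ_[p][X] := P - C 1 * (1 + X) ^ M with hG
  have hmap := Padic.map_sub_pow_eq_model (c := f.eval r / r ^ M) (η := 1) (M := M) hP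
    (by have := pow_ne_zero M hr; push_cast; field_simp)
  rw [← hG] at hmap
  have p0 : P.coeff 0 = 1 := by
    have : (P.map PadicInt.Coe.ringHom).coeff 0 = 1 := by
      rw [hP, coeff_zero_eq_eval_zero]; simp [eval_comp, hf]
    rw [coeff_map] at this
    have h2 : ((P.coeff 0 : ℤ_[p]) : ℚ_[p]) = 1 := this
    exact Subtype.ext h2
  have g0 : G.coeff 0 = 0 := by
    rw [hG, coeff_sub, coeff_C_mul, coeff_one_add_X_pow, p0]; simp
  have g1 : G.coeff 1 = P.coeff 1 - M := by
    rw [hG, coeff_sub, coeff_C_mul, coeff_one_add_X_pow]; simp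
  have g2 : 2 * G.coeff 2 = 2 * P.coeff 2 - (M : ℤ_[p]) ^ 2 + M := by
    have h2 : ((M.choose 2 : ℕ) : ℤ_[p]) * 2 = M * (M - 1) := by
      cases M with
      | zero => simp
      | succ n =>
        have := Nat.triangle_succ n
        rw [← Nat.choose_two_right] at this
        have h3 : ((n + 1).choose 2) * 2 = (n + 1) * n := by
          rw [Nat.choose_two_right]
          exact Nat.div_mul_cancel (by simpa [mul_comm] using (Nat.even_mul_succ_self n).two_dvd)
        have h4 := congrArg (Nat.cast : ℕ → ℤ_[p]) h3
        push_cast at h4 ⊢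
        rw [h4]; ring
    rw [hG, coeff_sub, coeff_C_mul, coeff_one_add_X_pow]
    linear_combination -h2
  have hG2 : ‖κ‖ ≤ ‖G.coeff 2‖ := by
    have h3 : ‖2 * G.coeff 2‖ = ‖κ‖ := by
      have h4 : 2 * G.coeff 2 = κ + (P.coeff 1 - M) * (P.coeff 1 + M - 1) := by
        rw [g2, hκd]; ring
      have h5 : ‖(P.coeff 1 - M) * (P.coeff 1 + M - 1)‖ < ‖κ‖ := by
        rw [norm_mul]
        refine (mul_le_of_le_one_right (norm_nonneg _) (PadicInt.norm_le_one _)).trans_lt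
          (hM1.trans_le ?_)
        rw [sq]
        exact mul_le_of_le_one_left hκ0.le hκ1
      rw [h4, PadicInt.norm_add_eq_max_of_ne h5.ne', max_eq_left h5.le]
    rw [← h3, norm_mul]
    exact mul_le_of_le_one_left (norm_nonneg _) (PadicInt.norm_le_one _)
  -- The root 0 of G is the root r of the new polynomial. Dividing it out leaves constant term a₁ -
  -- M, small and nonzero, and linear coefficient of norm at least ‖κ‖, so Hensel produces a second
  -- root.
  have hGX : G = X * G.divX := by
    have := X_mul_divX_add G
    rw [g0] at this
    simpa using this.symm
  have d0 : G.divX.coeff 0 = P.coeff 1 - M := by rw [coeff_divX, zero_add, g1]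
  have d1 : G.divX.coeff 1 = G.coeff 2 := by rw [coeff_divX]
  have hder (z : ℤ_[p]) : G.derivative.eval z =
      G.divX.eval z + z * G.divX.derivative.eval z := by
    conv_lhs => rw [hGX]
    simp
  have hb : (f.eval r)⁻¹ ≠ 0 := inv_ne_zero hf
  have hsub : P.coeff 1 - M ≠ 0 := sub_ne_zero.mpr hne
  constructor
  · have := Padic.simple_root_of_integral_model hb hmap (z := 0)
      (by rw [← coeff_zero_eq_eval_zero, g0])
      (by rw [hder, ← coeff_zero_eq_eval_zero, d0]; simpa using hsub)
    simpa using this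
  · obtain ⟨z, hz0, hz1, hz⟩ := PadicInt.exists_simple_root_norm_mul_le (P := G.divX)
      (by rw [d0, d1]; exact hM1.trans_le (by gcongr))
    rw [d0, d1] at hz
    have hzne : z ≠ 0 := by
      rintro rfl
      rw [← coeff_zero_eq_eval_zero, d0] at hz0
      exact hsub hz0
    refine ⟨z, hzne, ?_, Padic.simple_root_of_integral_model hb hmap ?_ ?_⟩
    · refine lt_of_mul_lt_mul_right (a := ‖κ‖) ?_ hκ0.le
      refine lt_of_le_of_lt ?_ hM2
      exact (mul_le_mul_of_nonneg_left hG2 (norm_nonneg z)).trans hz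
    · rw [hGX]; simp [hz0]
    · rw [hder, hz0, zero_add]
      exact mul_ne_zero hzne hz1

end Hensel

/-! ### Adding a monomial gains two roots -/

section Induction

variable {p : ℕ} [Fact p.Prime]

/-- Far from the origin a polynomial has the size of its leading monomial. -/
theorem Padic.exists_forall_norm_term_le {f : ℚ_[p][X]} (hf : f ≠ 0) :
    ∃ R : ℝ, ∀ r : ℚ_[p], R < ‖r‖ → f.eval r ≠ 0 ∧ ∀ i, ‖f.coeff i * r ^ i‖ ≤ ‖f.eval r‖ := by
  have hl : 0 < ‖f.leadingCoeff‖ := norm_pos_iff.mpr (leadingCoeff_ne_zero.mpr hf)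
  obtain ⟨B, hB⟩ := ((Finset.range (f.natDegree + 1)).image fun i => ‖f.coeff i‖).bddAbove
  refine ⟨max 1 (B / ‖f.leadingCoeff‖), fun r hr => ?_⟩
  obtain ⟨h1, h2⟩ := max_lt_iff.mp hr
  have hr0 : 0 < ‖r‖ := one_pos.trans h1
  set a : ℝ := ‖f.leadingCoeff * r ^ f.natDegree‖ with ha
  have ha0 : 0 < a := by rw [ha, norm_mul, norm_pow]; positivity
  have hlt : ∀ i < f.natDegree, ‖f.coeff i * r ^ i‖ < a := by
    intro i hi
    have hBi : ‖f.coeff i‖ ≤ B := hB (by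
      rw [Finset.mem_coe, Finset.mem_image]
      exact ⟨i, Finset.mem_range.mpr (by omega), rfl⟩)
    rw [ha, norm_mul, norm_mul, norm_pow, norm_pow]
    calc ‖f.coeff i‖ * ‖r‖ ^ i < (‖f.leadingCoeff‖ * ‖r‖) * ‖r‖ ^ i := by
          gcongr
          rw [mul_comm]
          exact hBi.trans_lt ((div_lt_iff₀ hl).mp h2)
      _ = ‖f.leadingCoeff‖ * ‖r‖ ^ (i + 1) := by ring
      _ ≤ _ := by
          gcongr
          · exact h1.le
          · omega
  have hsum : ‖∑ i ∈ Finset.range f.natDegree, f.coeff i * r ^ i‖ < a := by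
    rcases Nat.eq_zero_or_pos f.natDegree with h0 | h0
    · rw [h0]; simpa using ha0
    · obtain ⟨i, hi, hle⟩ := IsUltrametricDist.exists_norm_finsetSum_le
        (Finset.range f.natDegree) (fun i => f.coeff i * r ^ i)
      exact hle.trans_lt (hlt i (Finset.mem_range.mp (hi ⟨0, Finset.mem_range.mpr h0⟩)))
  have hfr : ‖f.eval r‖ = a := by
    rw [eval_eq_sum_range, Finset.sum_range_succ, coeff_natDegree, add_comm,
      IsUltrametricDist.norm_add_eq_max_of_norm_ne_norm hsum.ne', max_eq_left hsum.le]
  refine ⟨norm_pos_iff.mp (hfr ▸ ha0), fun i => ?_⟩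
  rw [hfr]
  rcases lt_trichotomy i f.natDegree with h | h | h
  · exact (hlt i h).le
  · rw [h, coeff_natDegree]
  · rw [coeff_eq_zero_of_natDegree_lt h]; simpa using ha0.le

/-- The polynomial is the sum of (aᵢrⁱ/f(r))(1 + X)ⁱ, and the hypothesis says that these scalars are
integral. -/
theorem Padic.exists_normalized_integral_model {f : ℚ_[p][X]} {r : ℚ_[p]} (h0 : f.eval r ≠ 0)
    (h : ∀ i, ‖f.coeff i * r ^ i‖ ≤ ‖f.eval r‖) :
    ∃ P : ℤ_[p][X], P.map PadicInt.Coe.ringHom = C (f.eval r)⁻¹ * f.comp (C r * (1 + X)) := by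
  have hb : ∀ i, ‖(f.eval r)⁻¹ * (f.coeff i * r ^ i)‖ ≤ 1 := fun i => by
    rw [norm_mul, norm_inv, inv_mul_le_one₀ (norm_pos_iff.mpr h0)]
    exact h i
  let b : ℕ → ℤ_[p] := fun i => ⟨(f.eval r)⁻¹ * (f.coeff i * r ^ i), hb i⟩
  refine ⟨∑ i ∈ Finset.range (f.natDegree + 1), C (b i) * (1 + X) ^ i, ?_⟩
  rw [Polynomial.map_sum, comp, eval₂_eq_sum_range, Finset.mul_sum]
  refine Finset.sum_congr rfl fun i _ => ?_
  simp only [Polynomial.map_mul, Polynomial.map_pow, Polynomial.map_add, Polynomial.map_one, map_X,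
    map_C]
  change C ((f.eval r)⁻¹ * (f.coeff i * r ^ i)) * (1 + X) ^ i = _
  rw [mul_pow, C_mul, C_mul, C_pow]
  ring

theorem Padic.exists_pow_norm_gt (p : ℕ) [Fact p.Prime] {m : ℕ} (hm : m ≠ 0) (R : ℝ) :
    ∃ w : ℚ_[p], R < ‖w ^ m‖ := by
  obtain ⟨w, hw⟩ := NormedField.exists_lt_norm ℚ_[p] (max 1 R)
  obtain ⟨h1, h2⟩ := max_lt_iff.mp hw
  refine ⟨w, h2.trans_le ?_⟩
  rw [norm_pow]
  exact le_self_pow₀ h1.le hm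

/-- The obstruction to separating two nearby roots is a nonzero polynomial in the base point. -/
theorem Padic.second_order_ne_zero {f : ℚ_[p][X]} {P : ℤ_[p][X]} {r : ℚ_[p]}
    (hr : r ≠ 0) (hf : f.eval r ≠ 0)
    (hP : P.map PadicInt.Coe.ringHom = C (f.eval r)⁻¹ * f.comp (C r * (1 + X)))
    (hW : (X * derivative (derivative f) * f - X * derivative f ^ 2 +
      f * derivative f).eval r ≠ 0) :
    2 * P.coeff 2 - P.coeff 1 ^ 2 + P.coeff 1 ≠ 0 := by
  have c1 : ((P.coeff 1 : ℤ_[p]) : ℚ_[p]) = (f.eval r)⁻¹ * (r * f.derivative.eval r) := by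
    have : (P.map PadicInt.Coe.ringHom).derivative.coeff 0 =
        (f.eval r)⁻¹ * (r * f.derivative.eval r) := by
      rw [hP, coeff_zero_eq_eval_zero]; simp [eval_comp, derivative_comp]
    rw [coeff_derivative, coeff_map] at this
    rw [← this]
    norm_num
    rfl
  have c2 : 2 * ((P.coeff 2 : ℤ_[p]) : ℚ_[p]) =
      (f.eval r)⁻¹ * (r ^ 2 * f.derivative.derivative.eval r) := by
    have : (P.map PadicInt.Coe.ringHom).derivative.derivative.coeff 0 =
        (f.eval r)⁻¹ * (r ^ 2 * f.derivative.derivative.eval r) := by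
      rw [hP, coeff_zero_eq_eval_zero]; simp [eval_comp, derivative_comp, sq, mul_assoc]
    rw [coeff_derivative, coeff_derivative, coeff_map] at this
    rw [← this]
    norm_num
    rw [mul_comm]
    rfl
  intro h
  have h' : 2 * ((P.coeff 2 : ℤ_[p]) : ℚ_[p]) - (P.coeff 1 : ℚ_[p]) ^ 2 + (P.coeff 1 : ℚ_[p]) = 0 := by
    have := congrArg (fun z : ℤ_[p] => (z : ℚ_[p])) h
    push_cast at this
    exact this
  rw [c2, c1] at h'
  field_simp at h'
  apply hW
  simp only [eval_add, eval_sub, eval_mul, eval_X, eval_pow]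
  refine mul_left_cancel₀ hr ?_
  linear_combination h'

theorem Finset.exists_pos_le_norm_sub {E : Type*} [NormedAddCommGroup E] (T : Finset E) :
    ∃ ε > 0, ∀ a ∈ T, ∀ b ∈ T, a ≠ b → ε ≤ ‖a - b‖ := by
  classical
  induction T using Finset.induction_on with
  | empty => exact ⟨1, one_pos, by simp⟩
  | insert x T hx ih =>
    obtain ⟨ε, hε, h⟩ := ih
    have : ∀ T' : Finset E, x ∉ T' → ∃ ε > 0, ∀ a ∈ T', ε ≤ ‖a - x‖ := by
      intro T' hT'
      rcases T'.eq_empty_or_nonempty with rfl | hne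
      · exact ⟨1, one_pos, by simp⟩
      · obtain ⟨a, ha, hmin⟩ := T'.exists_min_image (fun a => ‖a - x‖) hne
        exact ⟨‖a - x‖, norm_pos_iff.mpr (sub_ne_zero.mpr fun e => hT' (e ▸ ha)), hmin⟩
    obtain ⟨ε', hε', h'⟩ := this T hx
    refine ⟨min ε ε', lt_min hε hε', fun a ha b hb hab => ?_⟩
    rw [Finset.mem_insert] at ha hb
    rcases ha with rfl | ha <;> rcases hb with rfl | hb
    · exact absurd rfl hab
    · rw [norm_sub_rev]
      exact (min_le_right _ _).trans (h' b hb)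
    · exact (min_le_right _ _).trans (h' a ha)
    · exact (min_le_left _ _).trans (h a ha b hb hab)

/-- One more monomial yields two more simple roots among the `m`-th powers. -/
theorem Padic.exists_sparse_add_two_roots {m : ℕ} (hm : m ≠ 0) {f : ℚ_[p][X]} {T : Finset ℚ_[p]}
    (hne : T.Nonempty)
    (hT : ∀ s ∈ T, s ≠ 0 ∧ f.eval s = 0 ∧ f.derivative.eval s ≠ 0 ∧ ∃ w, w ^ m = s) :
    ∃ (g : ℚ_[p][X]) (T' : Finset ℚ_[p]), g.support.card ≤ f.support.card + 1 ∧
      T'.card = T.card + 2 ∧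
      ∀ s ∈ T', s ≠ 0 ∧ g.eval s = 0 ∧ g.derivative.eval s ≠ 0 ∧ ∃ w, w ^ m = s := by
  classical
  obtain ⟨s₀, hs₀⟩ := hne
  have hf : f ≠ 0 := by
    rintro rfl
    exact (hT s₀ hs₀).2.2.1 (by simp)
  -- W is f² times the derivative of xf'/f. At a root s₀ of f it equals -s₀f'(s₀)², nonzero when s₀
  -- is nonzero and simple.
  set W := X * derivative (derivative f) * f - X * derivative f ^ 2 + f * derivative f with hW
  have hW0 : W ≠ 0 := by
    intro h
    obtain ⟨h1, h2, h3, -⟩ := hT s₀ hs₀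
    have := congrArg (eval s₀) h
    simp [hW, h2, h1, h3] at this
  obtain ⟨R₁, hR₁⟩ := Padic.exists_forall_norm_term_le hf
  obtain ⟨R₂, hR₂⟩ := Padic.exists_forall_norm_term_le hW0
  obtain ⟨R₃, hR₃⟩ := (T.image fun s => ‖s‖).bddAbove
  obtain ⟨w, hw⟩ := Padic.exists_pow_norm_gt p hm (max (max R₁ R₂) (max R₃ 0))
  set r := w ^ m with hrw
  simp only [max_lt_iff] at hw
  obtain ⟨⟨hr1, hr2⟩, hr3, hr0⟩ := hw
  have hr : r ≠ 0 := norm_pos_iff.mp hr0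
  have hTr : ∀ s ∈ T, ‖s‖ < ‖r‖ := fun s hs =>
    (hR₃ (Finset.mem_coe.mpr (Finset.mem_image_of_mem _ hs))).trans_lt hr3
  obtain ⟨hfr, hcoef⟩ := hR₁ r hr1
  obtain ⟨P, hP⟩ := Padic.exists_normalized_integral_model hfr hcoef
  have hκ := Padic.second_order_ne_zero hr hfr hP (hR₂ r hr2).1
  obtain ⟨δ₁, hδ₁, hpow⟩ := PadicInt.exists_pow_eq_one_add p hm
  obtain ⟨ε, hε, hsep⟩ := T.exists_pos_le_norm_sub
  -- The three bounds keep the moved roots m-th powers, preserve their norms, and keep the old ones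
  -- distinct.
  set ε₀ := min δ₁ (min 1 (ε / ‖r‖)) with hε₀
  have hε₀pos : 0 < ε₀ := by positivity
  obtain ⟨δ, hδ, hnew⟩ := Padic.exists_two_simple_roots hr hfr hP hκ hε₀pos
  have hold : ∀ᶠ M : ℕ in Filter.atTop, ∀ s ∈ T, ∃ z : ℤ_[p], ‖z‖ < ε₀ ∧
      (f - C (f.eval r / r ^ M) * X ^ M).eval (s * (1 + z)) = 0 ∧
      (f - C (f.eval r / r ^ M) * X ^ M).derivative.eval (s * (1 + z)) ≠ 0 := by
    rw [Filter.eventually_all_finset]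
    intro s hs
    obtain ⟨h1, h2, h3, -⟩ := hT s hs
    exact Padic.eventually_exists_simple_root_near h2 h3 h1 (hTr s hs) hε₀pos _
  have hneq : ∀ᶠ M : ℕ in Filter.atTop, P.coeff 1 ≠ M := by
    by_cases h : ∃ n : ℕ, P.coeff 1 = n
    · obtain ⟨n, hn⟩ := h
      filter_upwards [Filter.eventually_gt_atTop n] with M hM
      rw [hn]
      exact_mod_cast hM.ne
    · exact Filter.Eventually.of_forall fun M hM => h ⟨M, hM⟩
  obtain ⟨A, hA⟩ := Filter.eventually_atTop.mp (hold.and hneq)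
  obtain ⟨M, hMA, hM⟩ := PadicInt.exists_natCast_near (P.coeff 1) hδ A
  obtain ⟨hMold, hMne⟩ := hA M hMA
  obtain ⟨hroot, z₀, hz₀, hz₀ε, hroot'⟩ := hnew M hM hMne
  choose! z hzε hz using hMold
  have hnear : ∀ {v : ℤ_[p]}, ‖v‖ < ε₀ → ‖v‖ < 1 ∧ ‖v‖ < ε / ‖r‖ ∧ ‖v‖ < δ₁ := by
    intro v hv
    rw [hε₀, lt_min_iff, lt_min_iff] at hv
    tauto
  have hunit : ∀ {v : ℤ_[p]}, ‖v‖ < ε₀ → ‖(1 + v : ℚ_[p])‖ = 1 := by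
    intro v hv
    have h1 : ‖(v : ℚ_[p])‖ < ‖(1 : ℚ_[p])‖ := by
      rw [norm_one]; exact (hnear hv).1
    rw [IsUltrametricDist.norm_add_eq_max_of_norm_ne_norm h1.ne', max_eq_left h1.le, norm_one]
  have hunit0 : ∀ {v : ℤ_[p]}, ‖v‖ < ε₀ → (1 + v : ℚ_[p]) ≠ 0 := fun hv =>
    norm_pos_iff.mp (by rw [hunit hv]; exact one_pos)
  have hispow : ∀ {s : ℚ_[p]} {v : ℤ_[p]}, (∃ w, w ^ m = s) → ‖v‖ < ε₀ →
      ∃ w, w ^ m = s * (1 + v) := by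
    rintro s v ⟨a, rfl⟩ hv
    obtain ⟨b, hb⟩ := hpow v (hnear hv).2.2
    refine ⟨a * b, ?_⟩
    rw [mul_pow, ← PadicInt.coe_pow, hb]
    push_cast
    ring
  have hinj : Set.InjOn (fun s => s * (1 + z s : ℚ_[p])) T := by
    intro a ha b hb hab
    by_contra hne
    have h1 := hsep a ha b hb hne
    have hsmall : ∀ s ∈ T, ‖s * z s‖ < ε := fun s hs => by
      rw [norm_mul]
      have h2 := (hnear (hzε s hs)).2.1
      rw [lt_div_iff₀ hr0] at h2
      refine lt_of_le_of_lt ?_ h2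
      rw [mul_comm]
      exact mul_le_mul_of_nonneg_left (hTr s hs).le (norm_nonneg _)
    have h3 : a - b = b * z b + -(a * z a) := by
      have : a * (1 + z a) = b * (1 + z b) := hab
      linear_combination this
    rw [h3] at h1
    exact absurd (h1.trans (IsUltrametricDist.norm_add_le_max _ _))
      (not_le.mpr (max_lt (hsmall b hb) (by rw [norm_neg]; exact hsmall a ha)))
  -- The moved old roots remain smaller than r, while both new roots have norm ‖r‖, so old and new
  -- cannot coincide.
  have hnorm : ∀ y ∈ T.image (fun s => s * (1 + z s : ℚ_[p])), ‖y‖ < ‖r‖ := by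
    intro y hy
    obtain ⟨s, hs, rfl⟩ := Finset.mem_image.mp hy
    rw [norm_mul, hunit (hzε s hs), mul_one]
    exact hTr s hs
  have hr' : ‖r * (1 + z₀ : ℚ_[p])‖ = ‖r‖ := by rw [norm_mul, hunit hz₀ε, mul_one]
  refine ⟨f - C (f.eval r / r ^ M) * X ^ M,
    insert r (insert (r * (1 + z₀)) (T.image fun s => s * (1 + z s))), ?_, ?_, ?_⟩
  · rw [sub_eq_add_neg, ← neg_mul, ← C_neg]
    exact ((Finset.card_le_card support_add).trans (Finset.card_union_le _ _)).trans
      (Nat.add_le_add_left card_support_C_mul_X_pow_le_one _)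
  · rw [Finset.card_insert_of_notMem, Finset.card_insert_of_notMem,
      Finset.card_image_of_injOn hinj]
    · intro h
      exact (hnorm _ h).ne hr'
    · intro h
      rcases Finset.mem_insert.mp h with h | h
      · have h1 : r * (z₀ : ℚ_[p]) = 0 := by linear_combination -h
        rcases mul_eq_zero.mp h1 with h2 | h2
        · exact hr h2
        · exact hz₀ (Subtype.ext h2)
      · exact (hnorm _ h).ne rfl
  · intro y hy
    rw [Finset.mem_insert, Finset.mem_insert] at hy
    rcases hy with rfl | rfl | hy
    · exact ⟨hr, hroot.1, hroot.2, w, rfl⟩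
    · exact ⟨mul_ne_zero hr (hunit0 hz₀ε), hroot'.1, hroot'.2, hispow ⟨w, rfl⟩ hz₀ε⟩
    · obtain ⟨s, hs, rfl⟩ := Finset.mem_image.mp hy
      exact ⟨mul_ne_zero (hT s hs).1 (hunit0 (hzε s hs)), (hz s hs).1, (hz s hs).2,
        hispow (hT s hs).2.2.2 (hzε s hs)⟩

/-- Simplicity of the roots is carried along because the inductive step needs it. The index is
shifted by one: the base case is x - 1. -/
theorem Padic.exists_sparse_with_pow_roots (p : ℕ) [Fact p.Prime] {m : ℕ} (hm : m ≠ 0) (t : ℕ) :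
    ∃ (f : ℚ_[p][X]) (T : Finset ℚ_[p]), f.support.card ≤ t + 2 ∧ T.card = 2 * t + 1 ∧
      ∀ s ∈ T, s ≠ 0 ∧ f.eval s = 0 ∧ f.derivative.eval s ≠ 0 ∧ ∃ w, w ^ m = s := by
  induction t with
  | zero =>
    refine ⟨X - C 1, {1}, ?_, by simp, ?_⟩
    · have h : (X - C 1 : ℚ_[p][X]) = C 1 * X ^ 1 + C (-1) * X ^ 0 := by simp [sub_eq_add_neg]
      rw [h]
      exact ((Finset.card_le_card support_add).trans (Finset.card_union_le _ _)).trans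
        (add_le_add (b := 1) (d := 1) card_support_C_mul_X_pow_le_one card_support_C_mul_X_pow_le_one)
    · intro s hs
      rw [Finset.mem_singleton] at hs
      subst hs
      exact ⟨one_ne_zero, by simp, by simp, 1, one_pow m⟩
  | succ t ih =>
    obtain ⟨f, T, hf, hT, h⟩ := ih
    obtain ⟨g, T', hg, hT', h'⟩ := Padic.exists_sparse_add_two_roots hm
      (Finset.card_pos.mp (by omega)) h
    exact ⟨g, T', by omega, by omega, h'⟩

end Induction

/-! ### Teichmüller lifts in a complete ultrametric field -/

section Teichmuller

theorem norm_pow_sub_pow_le_of_ultrametric {K : Type*} [NormedField K] [IsUltrametricDist K]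
    {a b : K} (ha : ‖a‖ ≤ 1) (hb : ‖b‖ ≤ 1) (n : ℕ) :
    ‖a ^ n - b ^ n‖ ≤ ‖a - b‖ * max ‖a - b‖ ‖(n : K)‖ := by
  have hint : ∀ k : ℕ, ‖(k : K)‖ ≤ 1 := fun k => IsUltrametricDist.norm_natCast_le_one K k
  -- This is the first-order Taylor expansion of aⁿ at b, with integral remainder coefficient c.
  have key : ∀ n : ℕ, ∃ c : K, ‖c‖ ≤ 1 ∧ a ^ n - b ^ n = (a - b) * ((a - b) * c + n * b ^ (n - 1)) := by
    intro n
    induction n with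
    | zero => exact ⟨0, by simp, by simp⟩
    | succ k ih =>
      obtain ⟨c, hc, h⟩ := ih
      refine ⟨a * c + k * b ^ (k - 1), ?_, ?_⟩
      · refine (IsUltrametricDist.norm_add_le_max _ _).trans (max_le ?_ ?_)
        · rw [norm_mul]; exact mul_le_one₀ ha (norm_nonneg _) hc
        · rw [norm_mul, norm_pow]
          exact mul_le_one₀ (hint k) (by positivity) (pow_le_one₀ (norm_nonneg _) hb)
      · have hk : (k : K) * b ^ (k - 1) * b = k * b ^ k := by
          cases k with
          | zero => simp
          | succ j => simp [pow_succ, mul_assoc]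
        rw [Nat.add_sub_cancel]
        push_cast
        linear_combination a * h + (a - b) * hk
  obtain ⟨c, hc, h⟩ := key n
  rw [h, norm_mul]
  refine mul_le_mul_of_nonneg_left ?_ (norm_nonneg _)
  refine (IsUltrametricDist.norm_add_le_max _ _).trans (max_le_max ?_ ?_)
  · rw [norm_mul]; exact mul_le_of_le_one_right (norm_nonneg _) hc
  · rw [norm_mul, norm_pow]
    exact mul_le_of_le_one_right (norm_nonneg _) (pow_le_one₀ (norm_nonneg _) hb)

/-- The Teichmüller representative of `x`, as the limit of `x ^ q ^ n`. -/
theorem exists_pow_eq_self_near {K : Type*} [NormedField K] [IsUltrametricDist K]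
    [CompleteSpace K] {q : ℕ} (hq : ‖(q : K)‖ < 1) {x : K} (hx : ‖x‖ ≤ 1)
    (hxq : ‖x ^ q - x‖ < 1) : ∃ w : K, w ^ q = w ∧ ‖w - x‖ < 1 := by
  set c := max ‖x ^ q - x‖ ‖(q : K)‖ with hc
  have hc1 : c < 1 := max_lt hxq hq
  have hc0 : 0 ≤ c := (norm_nonneg _).trans (le_max_left _ _)
  set u : ℕ → K := fun n => x ^ q ^ n with hu
  have hus (n : ℕ) : u (n + 1) = u n ^ q := by simp only [hu, pow_succ, pow_mul]
  have hu1 (n : ℕ) : ‖u n‖ ≤ 1 := by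
    simp only [hu, norm_pow]; exact pow_le_one₀ (norm_nonneg _) hx
  -- Taking q-th powers shrinks a difference of norm at most c by the factor c, so the increments
  -- decay geometrically.
  have hstep (n : ℕ) : ‖u (n + 1) - u n‖ ≤ c * c ^ n := by
    induction n with
    | zero => simp [hu, hc]
    | succ n ih =>
      rw [hus (n + 1), hus n]
      rw [hus n] at ih
      refine (norm_pow_sub_pow_le_of_ultrametric (hus n ▸ hu1 (n + 1)) (hu1 n) q).trans ?_
      have h2 : max ‖u n ^ q - u n‖ ‖(q : K)‖ ≤ c :=
        max_le (ih.trans (mul_le_of_le_one_right hc0 (pow_le_one₀ hc0 hc1.le))) (le_max_right _ _)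
      calc _ ≤ (c * c ^ n) * c := by gcongr
        _ = c * c ^ (n + 1) := by ring
  have hcau : CauchySeq u := by
    refine cauchySeq_of_le_geometric c c hc1 fun n => ?_
    rw [dist_comm, dist_eq_norm]
    exact hstep n
  obtain ⟨w, hw⟩ := cauchySeq_tendsto_of_complete hcau
  refine ⟨w, ?_, ?_⟩
  · have h1 : Filter.Tendsto (fun n => u (n + 1)) Filter.atTop (nhds w) :=
      hw.comp (Filter.tendsto_add_atTop_nat 1)
    simp only [hus] at h1
    exact tendsto_nhds_unique (hw.pow q) h1
  · have hbd (n : ℕ) : ‖u n - x‖ ≤ c := by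
      induction n with
      | zero => simpa [hu] using hc0
      | succ n ih =>
        have : u (n + 1) - x = (u (n + 1) - u n) + (u n - x) := by ring
        rw [this]
        exact (IsUltrametricDist.norm_add_le_max _ _).trans (max_le
          ((hstep n).trans (mul_le_of_le_one_right hc0 (pow_le_one₀ hc0 hc1.le))) ih)
    exact (le_of_tendsto (hw.sub_const x).norm (Filter.Eventually.of_forall hbd)).trans_lt hc1

end Teichmuller

/-! ### Roots of unity from the residue field -/

section LocalField

variable {p : ℕ} [Fact p.Prime] {K : Type*} [Field K] [Algebra ℚ_[p] K] [FiniteDimensional ℚ_[p] K]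

theorem padicValuationRing_residue_eq_zero_iff (x : padicValuationRing p K) :
    IsLocalRing.residue _ x = 0 ↔ spectralNorm ℚ_[p] K x < 1 := by
  rw [IsLocalRing.residue_eq_zero_iff, IsLocalRing.mem_maximalIdeal, mem_nonunits_iff, not_iff_comm,
    not_lt]
  have hx : spectralNorm ℚ_[p] K x ≤ 1 := x.2
  have hinv : spectralNorm ℚ_[p] K (x : K)⁻¹ = (spectralNorm ℚ_[p] K x)⁻¹ :=
    map_inv₀ (spectralMulAlgNorm ℚ_[p] K) (x : K)
  constructor
  · intro h
    have h0 : (x : K) ≠ 0 := by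
      intro h0
      rw [h0, spectralNorm_zero] at h
      exact absurd h (by norm_num)
    have hm : (x : K)⁻¹ ∈ padicValuationRing p K := hinv.le.trans (inv_le_one_of_one_le₀ h)
    exact IsUnit.of_mul_eq_one ⟨_, hm⟩ (Subtype.ext (mul_inv_cancel₀ h0))
  · rintro ⟨u, rfl⟩
    have h1 : spectralNorm ℚ_[p] K ((u⁻¹ : (padicValuationRing p K)ˣ) : padicValuationRing p K) ≤ 1 :=
      (u⁻¹ : (padicValuationRing p K)ˣ).1.2
    have hmul : ((u : padicValuationRing p K) : K) *
        ((u⁻¹ : (padicValuationRing p K)ˣ) : padicValuationRing p K) = 1 :=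
      congrArg Subtype.val u.mul_inv
    have hone := map_mul (spectralMulAlgNorm ℚ_[p] K) ((u : padicValuationRing p K) : K)
      ((u⁻¹ : (padicValuationRing p K)ˣ) : padicValuationRing p K)
    rw [hmul, map_one] at hone
    calc (1 : ℝ) = _ := hone
      _ ≤ _ := mul_le_of_le_one_right (spectralNorm_nonneg _) h1

/-- Any lift of a residue satisfies x^q ≡ x, so it is congruent to a solution of w^q = w. Such a w
reduces to the given residue, which yields injectivity and, as the residue is a unit, w ≠ 0. -/
theorem exists_rootsOfUnity_lift
    [Finite (IsLocalRing.ResidueField (padicValuationRing p K))] :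
    ∃ w : (IsLocalRing.ResidueField (padicValuationRing p K))ˣ → K, Function.Injective w ∧
      ∀ u, w u ^ (Nat.card (IsLocalRing.ResidueField (padicValuationRing p K)) - 1) = 1 := by
  set k := IsLocalRing.ResidueField (padicValuationRing p K) with hk
  set q := Nat.card k with hq
  let := Fintype.ofFinite k
  have hqF : q = Fintype.card k := Nat.card_eq_fintype_card
  let : NormedField K := spectralNorm.normedField ℚ_[p] K
  have hult : IsUltrametricDist K :=
    IsUltrametricDist.isUltrametricDist_of_isNonarchimedean_norm isNonarchimedean_spectralNorm
  have hcomp : CompleteSpace K := spectralNorm.completeSpace ℚ_[p] K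
  have hres (x : padicValuationRing p K) : IsLocalRing.residue _ x = 0 ↔ ‖(x : K)‖ < 1 :=
    padicValuationRing_residue_eq_zero_iff x
  have hqn : ‖(q : K)‖ < 1 := by
    have := (hres (q : padicValuationRing p K)).mp (by
      rw [map_natCast, hqF]; exact FiniteField.cast_card_eq_zero k)
    simpa using this
  have hex : ∀ u : kˣ, ∃ w : padicValuationRing p K, IsLocalRing.residue _ w = (u : k) ∧
      (w : K) ^ q = w := by
    intro u
    obtain ⟨x, hx⟩ := IsLocalRing.residue_surjective (u : k)
    have hx1 : ‖(x : K)‖ ≤ 1 := x.2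
    have hxq : ‖(x : K) ^ q - x‖ < 1 := by
      have := (hres (x ^ q - x)).mp (by
        rw [map_sub, map_pow, hx, hqF, FiniteField.pow_card, sub_self])
      simpa using this
    obtain ⟨w, hw, hwx⟩ := exists_pow_eq_self_near hqn hx1 hxq
    have hw1 : ‖w‖ ≤ 1 := by
      have : w = (w - x) + x := by ring
      rw [this]
      exact (IsUltrametricDist.norm_add_le_max _ _).trans (max_le hwx.le hx1)
    obtain ⟨y, rfl⟩ : ∃ y : padicValuationRing p K, (y : K) = w := ⟨⟨w, hw1⟩, rfl⟩
    refine ⟨y, ?_, hw⟩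
    have h2 := (hres (y - x)).mpr (by rw [AddSubgroupClass.coe_sub]; exact hwx)
    rw [map_sub, sub_eq_zero] at h2
    rw [h2, hx]
  choose w hwu hw using hex
  refine ⟨fun u => w u, fun u v huv => ?_, fun u => ?_⟩
  · have : w u = w v := Subtype.ext huv
    exact Units.ext (by rw [← hwu u, ← hwu v, this])
  · have h0 : (w u : K) ≠ 0 := by
      intro h0
      have h1 : w u = 0 := Subtype.ext h0
      have := hwu u
      rw [h1, map_zero] at this
      exact u.ne_zero this.symm
    have hqpos : 0 < q := Nat.card_pos
    refine mul_right_cancel₀ h0 ?_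
    rw [← pow_succ, Nat.sub_add_cancel hqpos, hw, one_mul]

end LocalField

/-- Substituting `x ^ m` in a polynomial over a subfield multiplies by the number of `m`-th roots
of unity the number of roots that are `m`-th powers. -/
theorem le_B₁_of_pow_roots {F K : Type*} [Field F] [Field K] [Algebra F K] {m t : ℕ} (hm : m ≠ 0)
    {f : F[X]} (hf : f ≠ 0) (hft : f.support.card ≤ t + 1) {T : Finset F}
    (hT : ∀ s ∈ T, s ≠ 0 ∧ f.eval s = 0 ∧ ∃ w, w ^ m = s) {ι : Type*} [Finite ι] {w : ι → K}
    (hw : Function.Injective w) (hwm : ∀ u, w u ^ m = 1) :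
    ((T.card * Nat.card ι : ℕ) : ℕ∞) ≤ B₁ t K := by
  classical
  have hm' : 0 < m := Nat.pos_of_ne_zero hm
  set g : K[X] := (expand F m f).map (algebraMap F K) with hg
  have hinj : Function.Injective (algebraMap F K) := (algebraMap F K).injective
  have hg0 : g ≠ 0 := by
    rw [hg, Polynomial.map_ne_zero_iff hinj]
    exact (expand_ne_zero hm').mpr hf
  have hgs : g.support.card ≤ t + 1 := by
    rw [hg, support_map_of_injective _ hinj]
    refine le_trans ?_ hft
    have : (expand F m f).support ⊆ f.support.image (· * m) := by
      intro n hn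
      rw [mem_support_iff, coeff_expand hm'] at hn
      split_ifs at hn with hd
      · exact Finset.mem_image.mpr ⟨n / m, mem_support_iff.mpr hn, Nat.div_mul_cancel hd⟩
      · exact absurd rfl hn
    exact (Finset.card_le_card this).trans Finset.card_image_le
  choose! z hz using fun s hs => (hT s hs).2.2
  have hw0 (u : ι) : w u ≠ 0 := fun h => by
    have := hwm u
    rw [h, zero_pow hm] at this
    exact zero_ne_one this
  have hz0 : ∀ s ∈ T, z s ≠ 0 := fun s hs h => by
    have := hz s hs
    rw [h, zero_pow hm] at this
    exact (hT s hs).1 this.symm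
  -- The m-th power of such a product recovers s; cancelling the chosen root of s then recovers the
  -- root of unity.
  let φ : T × ι → K := fun a => algebraMap F K (z a.1) * w a.2
  have hφm (a : T × ι) : φ a ^ m = algebraMap F K a.1 := by
    simp only [φ]
    rw [mul_pow, hwm, mul_one, ← map_pow, hz a.1 a.1.2]
  have hφ : Function.Injective φ := by
    rintro ⟨s, u⟩ ⟨s', u'⟩ h
    have h1 : s = s' := by
      have := congrArg (· ^ m) h
      simp only [hφm] at this
      exact Subtype.ext (hinj this)
    subst h1
    have h2 : w u = w u' := mul_left_cancel₀
      ((map_ne_zero (algebraMap F K)).mpr (hz0 s s.2)) h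
    rw [hw h2]
  have hsub : Set.range φ ⊆ nonzeroRoots g := by
    rintro _ ⟨a, rfl⟩
    refine ⟨mul_ne_zero ((map_ne_zero (algebraMap F K)).mpr (hz0 _ a.1.2)) (hw0 _), ?_⟩
    rw [IsRoot.def, hg, map_expand, expand_eval, hφm, eval_map_apply, (hT _ a.1.2).2.1, map_zero]
  calc ((T.card * Nat.card ι : ℕ) : ℕ∞) = (Set.range φ).encard := by
        rw [← Set.image_univ, hφ.encard_image, Set.encard_univ, ENat.card_eq_coe_natCard,
          Nat.card_prod, Nat.card_eq_fintype_card (α := T), Fintype.card_coe]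
    _ ≤ (nonzeroRoots g).encard := Set.encard_le_encard hsub
    _ ≤ B₁ t K := le_iSup₂_of_le g hg0 (le_iSup_of_le hgs le_rfl)

theorem theorem99 (p : ℕ) [Fact p.Prime] (hp : Odd p)
    (K : Type*) [Field K] [Algebra ℚ_[p] K] [FiniteDimensional ℚ_[p] K]
    (q : ℕ) (hq : Nat.card (IsLocalRing.ResidueField (padicValuationRing p K)) = q)
    (t : ℕ) (ht : 1 ≤ t) :
    (((2 * t - 1) * (q - 1) : ℕ) : ℕ∞) ≤ B₁ t K := by
  -- `Nat.card` of an infinite type is 0, so q - 1 > 0 already forces the residue field to be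
  -- finite; otherwise the bound is trivial.
  rcases Nat.eq_zero_or_pos (q - 1) with h0 | hpos
  · simp [h0]
  subst hq
  have hfin : Finite (IsLocalRing.ResidueField (padicValuationRing p K)) :=
    Nat.finite_of_card_ne_zero (by omega)
  obtain ⟨w, hw, hwm⟩ := exists_rootsOfUnity_lift (p := p) (K := K)
  obtain ⟨f, T, hf, hT, h⟩ := Padic.exists_sparse_with_pow_roots p hpos.ne' (t - 1)
  obtain ⟨s, hs⟩ := Finset.card_pos.mp (by omega : 0 < T.card)
  have hf0 : f ≠ 0 := by
    rintro rfl
    exact (h s hs).2.2.1 (by simp)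
  have := le_B₁_of_pow_roots (t := t) hpos.ne' hf0 (by omega)
    (fun s hs => ⟨(h s hs).1, (h s hs).2.1, (h s hs).2.2.2⟩) hw hwm
  rwa [Nat.card_units, hT, show 2 * (t - 1) + 1 = 2 * t - 1 by omega] at this
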